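/- A *signature* $\sigma$ is a finite set of relation symbols $R$, each with an arity $\operatorname{ar}(R)\ge 1$. Let $\mathbb{Q}_\infty=\mathbb{Q}\cup\{\infty\}$, with $0\cdot\infty=0$ and $c\cdot\infty=\infty$ for $c>0$. A *valued $\sigma$-structure* $\mathbf{A}$ is a finite set $A$ together with a function $R^{\mathbf{A}}:A^{\operatorname{ar}(R)}\to\mathbb{Q}_\infty$ for each $R\in\sigma$. An *input structure* $\mathbf{X}$ is a valued $\sigma$-structure all of whose values lie in $\mathbb{Q}_{\ge 0}$; its set of *constraints* $\mathcal{C}_{\mathbf{X}}$ consists of the formal expressions $R(\mathbf{x})$ with $R\in\sigma$, $\mathbf{x}\in X^{\operatorname{ar}(R)}$ and $R^{\mathbf{X}}(\mathbf{x})>0$. Put $$\operatorname{Opt}(\mathbf{X},\mathbf{A})=\min_{h:X\to A}\ \sum_{R\in\sigma}\ \sum_{\mathbf{x}\in X^{\operatorname{ar}(R)}}R^{\mathbf{X}}(\mathbf{x})\,R^{\mathbf{A}}(h(\mathbf{x})),$$ where $h$ is applied componentwise (and $\operatorname{Opt}(\mathbf{X},\mathbf{A})=\infty$ if there is no map $X\to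 A$). In the problem $\mathrm{PVCSP}(\mathbf{A},\mathbf{B})$ the instances are the pairs $(\mathbf{X},\tau)$ of an input structure $\mathbf{X}$ and a threshold $\tau\in\mathbb{Q}$; such a pair is a Yes instance if $\operatorname{Opt}(\mathbf{X},\mathbf{A})\le\tau$ and a No instance if $\operatorname{Opt}(\mathbf{X},\mathbf{B})>\tau$. The pair $(\mathbf{A},\mathbf{B})$ of valued $\sigma$-structures is a *promise valued template* if no instance is both a Yes and a No instance. *Iterated degree.* The factor graph of an input structure $\mathbf{X}$ is the bipartite graph with vertex set $X\cup\mathcal{C}_{\mathbf{X}}$ in which $x\in X$ and $R(\mathbf{x})\in\mathcal{C}_{\mathbf{X}}$ are adjacent iff $x$ is an entry of $\mathbf{x}$; this edge has the label $(S,R,q)$ with $S=\{i: x_i=x\}$ and $q=R^{\mathbf{X}}(\mathbf{x})$. For a vertex $v$, let $\delta_0(v)$ be one of two distinct symbols, according to whether $v\in X$ or $v\in\mathcal{C}_{\mathbf{X}}$, and for $j\ge1$ let $\delta_j(v)$ be the multiset of the pairs (label of the edge $\{v,w\}$, $\delta_{j-1}(w)$) over all neighbours $w$ of $v$. Write $\delta(v)=(\delta_0(v),\delta_1(v),\dots)$.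 For input structures, $\mathbf{X}_1\equiv_1\mathbf{X}_2$ means that the multisets of the sequences $\delta(v)$, over all vertices $v$ of the respective factor graphs, are equal. $\mathrm{PVCSP}(\mathbf{A},\mathbf{B})$ is *closed under $\equiv_1$-equivalence* if $\operatorname{Opt}(\mathbf{X}_2,\mathbf{B})\le\operatorname{Opt}(\mathbf{X}_1,\mathbf{A})$ for all input structures with $\mathbf{X}_1\equiv_1\mathbf{X}_2$. *Linear program.* $\mathrm{SA}^1(\mathbf{X},\mathbf{A})$ has rational variables $p_x(a)\in[0,1]$ for $x\in X$, $a\in A$, and $p_{R(\mathbf{x})}(\mathbf{a})\in[0,1]$ for $R(\mathbf{x})\in\mathcal{C}_{\mathbf{X}}$, $\mathbf{a}\in A^{\operatorname{ar}(R)}$, subject to 1. $\sum_{a\in A}p_x(a)=1$ for every $x\in X$; 2. $p_{x_i}(a)=\sum_{\mathbf{a}\in A^{\operatorname{ar}(R)},\,a_i=a}p_{R(\mathbf{x})}(\mathbf{a})$ for all $R(\mathbf{x})\in\mathcal{C}_{\mathbf{X}}$, $1\le i\le\operatorname{ar}(R)$ and $a\in A$; 3. $p_{R(\mathbf{x})}(\mathbf{a})=0$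 whenever $R^{\mathbf{A}}(\mathbf{a})=\infty$; 4. $p_{R(\mathbf{x})}(\mathbf{a})=0$ whenever $x_i=x_j$ and $a_i\ne a_j$ for some $i,j$. $\operatorname{Opt}^{\mathrm{SA}^1}(\mathbf{X},\mathbf{A})$ is the minimum of $\sum_{R(\mathbf{x})\in\mathcal{C}_{\mathbf{X}}}\sum_{\mathbf{a}\in A^{\operatorname{ar}(R)}}p_{R(\mathbf{x})}(\mathbf{a})\,R^{\mathbf{X}}(\mathbf{x})\,R^{\mathbf{A}}(\mathbf{a})$ over all feasible solutions, and $\infty$ if there is none. $\mathrm{SA}^1$ *decides* $\mathrm{PVCSP}(\mathbf{A},\mathbf{B})$ if $\operatorname{Opt}(\mathbf{X},\mathbf{B})\le\operatorname{Opt}^{\mathrm{SA}^1}(\mathbf{X},\mathbf{A})$ for every input structure $\mathbf{X}$. **Theorem.** Let $(\mathbf{A},\mathbf{B})$ be a promise valued template of signature $\sigma$. Then $\mathrm{PVCSP}(\mathbf{A},\mathbf{B})$ is closed under $\equiv_1$-equivalence if and only if $\mathrm{SA}^1$ decides $\mathrm{PVCSP}(\mathbf{A},\mathbf{B})$. -/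

import Mathlib

noncomputable section

namespace PVCSP

universe w u v

/-- A signature: finitely many relation symbols, each with a positive arity. -/
structure Signature where
  Symbol : Type w
  [fintypeSymbol : Fintype Symbol]
  arity : Symbol → ℕ
  arity_pos : ∀ R, 0 < arity R

attribute [instance] Signature.fintypeSymbol

/-- A valued structure: a finite universe with, for every symbol, a valued relation with values in
`ℚ ∪ {∞}`, written `WithTop ℚ`. In `WithTop ℚ` one has `0 * ⊤ = 0` and `c * ⊤ = ⊤` for `c > 0`. -/
structure ValuedStructure (σ : Signature.{w}) where
  Carrier : Type u
  [fintypeCarrier : Fintype Carrier]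
  rel : ∀ R : σ.Symbol, (Fin (σ.arity R) → Carrier) → WithTop ℚ

attribute [instance] ValuedStructure.fintypeCarrier

/-- An input: a non-negative finite-valued structure. -/
structure InputStructure (σ : Signature.{w}) where
  Carrier : Type
  [fintypeCarrier : Fintype Carrier]
  weight : ∀ R : σ.Symbol, (Fin (σ.arity R) → Carrier) → ℚ≥0

attribute [instance] InputStructure.fintypeCarrier

variable {σ : Signature.{w}}

/-- `Val(X, A, h)`, the value of the map `h : X → A`. -/
def val (X : InputStructure σ) (A : ValuedStructure.{w, u} σ) (h : X.Carrier → A.Carrier) :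
    WithTop ℚ :=
  ∑ R : σ.Symbol, ∑ x : Fin (σ.arity R) → X.Carrier,
    (((X.weight R x : ℚ≥0) : ℚ) : WithTop ℚ) * A.rel R (h ∘ x)

open Classical in
/-- `Opt(X, A)`, the minimum of `Val(X, A, h)` over all maps `h : X → A` (it is `∞` if there is no
such map at all). -/
def opt (X : InputStructure σ) (A : ValuedStructure.{w, u} σ) : WithTop ℚ :=
  (Finset.univ : Finset (X.Carrier → A.Carrier)).inf (val X A)

/-- The pairs (input, threshold) that have to be answered Yes. -/
def yesInstances (A : ValuedStructure.{w, u} σ) : Set (InputStructure σ × ℚ) :=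
  {I | opt I.1 A ≤ (I.2 : WithTop ℚ)}

/-- The pairs (input, threshold) that have to be answered No. -/
def noInstances (B : ValuedStructure.{w, v} σ) : Set (InputStructure σ × ℚ) :=
  {I | (I.2 : WithTop ℚ) < opt I.1 B}

/-- `(A, B)` is a promise valued template: no instance is both a Yes and a No instance. -/
def IsTemplate (A : ValuedStructure.{w, u} σ) (B : ValuedStructure.{w, v} σ) : Prop :=
  Disjoint (yesInstances A) (noInstances B)

namespace InputStructure

/-- The constraints `R(x)` of an input: symbol and tuple of positive weight. -/
def Constraint (X : InputStructure σ) : Type w :=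
  {c : Σ R : σ.Symbol, (Fin (σ.arity R) → X.Carrier) // 0 < X.weight c.1 c.2}

instance (X : InputStructure σ) : Fintype X.Constraint :=
  Fintype.ofFinite
    {c : Σ R : σ.Symbol, (Fin (σ.arity R) → X.Carrier) // 0 < X.weight c.1 c.2}

namespace Constraint

variable {X : InputStructure σ}

/-- The relation symbol of a constraint. -/
def symb (c : X.Constraint) : σ.Symbol := c.1.1

/-- The tuple of a constraint. -/
def tuple (c : X.Constraint) : Fin (σ.arity c.symb) → X.Carrier := c.1.2

/-- The weight of a constraint. -/
def wt (c : X.Constraint) : ℚ≥0 := X.weight c.symb c.tuple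

end Constraint

end InputStructure

/-- Edge labels `(S, R, q)` of factor graphs: a symbol `R`, a set `S` of positions of `R`, and a
weight `q`. -/
def Label (σ : Signature.{w}) : Type w :=
  Σ R : σ.Symbol, Set (Fin (σ.arity R)) × ℚ≥0

/-- The label of the edge between a variable and a constraint in which it occurs. -/
def edgeLabel (X : InputStructure σ) (x : X.Carrier) (c : X.Constraint) : Label σ :=
  ⟨c.symb, {i | c.tuple i = x}, c.wt⟩

/-- The possible values of the `j`-th iterated degree. -/
def DegreeType (σ : Signature.{w}) : ℕ → Type w
  | 0 => ULift.{w} Bool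
  | j + 1 => Multiset (Label σ × DegreeType σ j)

open Classical in
/-- The `j`-th iterated degree of a node of the factor graph of `X`. The nodes are the variables
and the constraints; a variable and a constraint are adjacent iff the variable occurs in the tuple
of the constraint. At level `0` variables and constraints get two different symbols; at level
`j + 1` a node gets the multiset of pairs (edge label, `j`-th iterated degree of the neighbour),
one for each neighbour. -/
def iteratedDegreeAt (X : InputStructure σ) :
    ∀ j : ℕ, X.Carrier ⊕ X.Constraint → DegreeType σ j
  | 0, .inl _ => ULift.up false
  | 0, .inr _ => ULift.up true
  | j + 1, .inl x =>
      ((Finset.univ : Finset X.Constraint).filter (fun c => x ∈ Set.range c.tuple)).val.map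
        (fun c => (edgeLabel X x c, iteratedDegreeAt X j (.inr c)))
  | j + 1, .inr c =>
      ((Finset.univ : Finset X.Carrier).filter (fun x => x ∈ Set.range c.tuple)).val.map
        (fun x => (edgeLabel X x c, iteratedDegreeAt X j (.inl x)))

/-- The iterated degree of a node: the sequence of its `j`-th iterated degrees, `j = 0, 1, …`. -/
def iteratedDegree (X : InputStructure σ) (n : X.Carrier ⊕ X.Constraint) :
    ∀ j : ℕ, DegreeType σ j :=
  fun j => iteratedDegreeAt X j n

/-- The iterated degree sequence of `X`: the multiset of the iterated degrees of all variables and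
constraints. -/
def degreeSequence (X : InputStructure σ) : Multiset (∀ j : ℕ, DegreeType σ j) :=
  (Finset.univ : Finset (X.Carrier ⊕ X.Constraint)).val.map (iteratedDegree X)

/-- The relation `X₁ ≡₁ X₂`: the same iterated degree sequence. -/
def WLEquiv (X₁ X₂ : InputStructure σ) : Prop :=
  degreeSequence X₁ = degreeSequence X₂

/-- `PVCSP(A, B)` is closed under `≡₁`-equivalence. -/
def ClosedUnderWL (A : ValuedStructure.{w, u} σ) (B : ValuedStructure.{w, v} σ) : Prop :=
  ∀ X₁ X₂ : InputStructure σ, WLEquiv X₁ X₂ → opt X₂ B ≤ opt X₁ A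

/-- A rational assignment to the variables `p_x(a)` and `p_{R(x)}(a)` of the linear program
`SA¹(X, A)`. -/
structure SAAssignment (X : InputStructure σ) (A : ValuedStructure.{w, u} σ) where
  onVar : X.Carrier → A.Carrier → ℚ
  onCon : ∀ c : X.Constraint, (Fin (σ.arity c.symb) → A.Carrier) → ℚ

open Classical in
/-- Feasibility for `SA¹(X, A)`. -/
structure SAAssignment.IsFeasible {X : InputStructure σ} {A : ValuedStructure.{w, u} σ}
    (p : SAAssignment X A) : Prop where
  onVar_mem : ∀ x a, p.onVar x a ∈ Set.Icc (0 : ℚ) 1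
  onCon_mem : ∀ c a, p.onCon c a ∈ Set.Icc (0 : ℚ) 1
  sum_onVar : ∀ x, ∑ a : A.Carrier, p.onVar x a = 1
  marginal : ∀ (c : X.Constraint) (i : Fin (σ.arity c.symb)) (a : A.Carrier),
    p.onVar (c.tuple i) a =
      ∑ t : Fin (σ.arity c.symb) → A.Carrier with t i = a, p.onCon c t
  infinite_cost : ∀ (c : X.Constraint) (t : Fin (σ.arity c.symb) → A.Carrier),
    A.rel c.symb t = ⊤ → p.onCon c t = 0
  repetition : ∀ (c : X.Constraint) (t : Fin (σ.arity c.symb) → A.Carrier)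
    (i j : Fin (σ.arity c.symb)), c.tuple i = c.tuple j → t i ≠ t j → p.onCon c t = 0

/-- The objective function of `SA¹(X, A)`. -/
def SAAssignment.objective {X : InputStructure σ} {A : ValuedStructure.{w, u} σ}
    (p : SAAssignment X A) : WithTop ℚ :=
  ∑ c : X.Constraint, ∑ t : Fin (σ.arity c.symb) → A.Carrier,
    (p.onCon c t : WithTop ℚ) * ((c.wt : ℚ) : WithTop ℚ) * A.rel c.symb t

/-- The inclusion of `ℚ ∪ {∞}` into the extended real line. -/
def toEReal (q : WithTop ℚ) : EReal :=
  WithTop.recTopCoe (⊤ : EReal) (fun r : ℚ => ((r : ℝ) : EReal)) q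

/-- `Opt^{SA¹}(X, A)`, the optimum of the linear program `SA¹(X, A)` over its rational solutions;
it is `∞` if the program is infeasible. It is taken as an infimum in the (complete) extended real
line, which is the minimum whenever the minimum exists. -/
def optSA (X : InputStructure σ) (A : ValuedStructure.{w, u} σ) : EReal :=
  sInf {r : EReal | ∃ p : SAAssignment X A, p.IsFeasible ∧ r = toEReal p.objective}

/-- `SA¹` decides `PVCSP(A, B)`. -/
def SADecides (A : ValuedStructure.{w, u} σ) (B : ValuedStructure.{w, v} σ) : Prop :=
  ∀ X : InputStructure σ, toEReal (opt X B) ≤ optSA X A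

end PVCSP

end

/-!
A labelling of one input structure and a rational solution of `SA¹` for another carry the same
information, up to `≡₁`-equivalence.

A rational solution on `X` with common denominator `M` prescribes how often each label occurs
among `M` copies of a variable, and how often each tuple of labels occurs among `M` copies of a
constraint. The marginal conditions say exactly that the copies of the constraints can be attached
to the copies of the variables, by a permutation of `Fin M` for each incidence, in such a way that
these prescriptions are met. The result is an `M`-fold cover of `X` with a labelling of value `M`
times the objective (`SAAssignment.IsFeasible.exists_cover`). All `M`-fold covers of `X` are
`≡₁`-equivalent (`wlEquiv_cover`), and one of them is the disjoint union of `M` copies of `X`, whose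
optimum is at least `M` times that of `X` (`nsmul_opt_le_opt_cover_one`). Closure under `≡₁` applied
to these two covers, divided by `M`, bounds `opt X B` by the objective.

Conversely, let `X₁ ≡₁ X₂` and let `h` be a labelling of `X₁` of finite value. Giving each node of
`X₂` the empirical distribution of `h` on the nodes of `X₁` with the same iterated degree defines an
assignment for `X₂` (`averageAssignment`). It satisfies the marginal conditions because the number
of constraints of a given class in which a variable occurs at given positions depends only on the
iterated degree of the variable (`exists_card_conClass_filter`), and its objective is the value of
`h` because corresponding classes have the same size (`sum_average_fiber`). The counting needs the
multiset of full iterated degrees of the neighbours, which is determined by the full iterated degree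
of the node since finitely many nodes are separated at a finite level
(`neighborhood_eq_of_iteratedDegree_eq`).
-/

noncomputable section

namespace PVCSP

universe w u v

variable {σ : Signature.{w}}

/-! ### Values as sums over constraints -/

theorem val_eq_sum_constraint (X : InputStructure σ) (A : ValuedStructure.{w, u} σ)
    (h : X.Carrier → A.Carrier) :
    val X A h = ∑ c : X.Constraint, ((c.wt : ℚ) : WithTop ℚ) * A.rel c.symb (h ∘ c.tuple) := by
  classical
  unfold val
  rw [← Fintype.sum_sigma' (fun R x =>
    (((X.weight R x : ℚ≥0) : ℚ) : WithTop ℚ) * A.rel R (h ∘ x))]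
  symm
  refine Fintype.sum_of_injective (fun c : X.Constraint => c.1) Subtype.val_injective _ _ ?_ ?_
  · rintro ⟨R, x⟩ hx
    have h0 : X.weight R x = 0 := by
      by_contra hne
      exact hx ⟨⟨⟨R, x⟩, pos_iff_ne_zero.mpr hne⟩, rfl⟩
    simp [h0]
  · intro c
    rfl

theorem opt_le_val (X : InputStructure σ) (A : ValuedStructure.{w, u} σ)
    (h : X.Carrier → A.Carrier) : opt X A ≤ val X A h := by
  classical
  exact Finset.inf_le (Finset.mem_univ h)

theorem toEReal_le_toEReal {a b : WithTop ℚ} : toEReal a ≤ toEReal b ↔ a ≤ b := by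
  induction a using WithTop.recTopCoe <;> induction b using WithTop.recTopCoe <;>
    simp [toEReal]

theorem le_of_nsmul_le_nsmul_withTop {M : ℕ} (hM : 0 < M) {a b : WithTop ℚ}
    (h : M • a ≤ M • b) : a ≤ b := by
  induction b using WithTop.recTopCoe with
  | top => exact le_top
  | coe b =>
    induction a using WithTop.recTopCoe with
    | top =>
      obtain ⟨n, rfl⟩ := Nat.exists_eq_succ_of_ne_zero hM.ne'
      rw [← WithTop.coe_nsmul, succ_nsmul, WithTop.add_top, top_le_iff] at h
      exact absurd h (WithTop.coe_ne_top)
    | coe a =>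
      rw [← WithTop.coe_nsmul, ← WithTop.coe_nsmul, WithTop.coe_le_coe] at h
      exact WithTop.coe_le_coe.mpr (le_of_nsmul_le_nsmul_right hM.ne' h)

/-! ### Covers of input structures -/

open Classical in
/-- The `M`-fold cover of `X` with voltage permutations `π`: every variable `x` has the copies
`(x, k)` with `k : Fin M`, and every constraint `R(x)` has, for each `k : Fin M`, one copy of the
same weight, whose `i`-th entry is the copy of `x i` with number `π (R, x) (x i) k`. -/
def cover (X : InputStructure σ) (M : ℕ)
    (π : (Σ R : σ.Symbol, (Fin (σ.arity R) → X.Carrier)) → X.Carrier → Equiv.Perm (Fin M)) :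
    InputStructure σ where
  Carrier := X.Carrier × Fin M
  weight R y := if ∃ k, ∀ i, (y i).2 = π ⟨R, fun i => (y i).1⟩ (y i).1 k
    then X.weight R (fun i => (y i).1) else 0

section Cover

variable {X : InputStructure σ} {M : ℕ}
  {π : (Σ R : σ.Symbol, (Fin (σ.arity R) → X.Carrier)) → X.Carrier → Equiv.Perm (Fin M)}

theorem cover_weight_lift (π) (R : σ.Symbol) (x : Fin (σ.arity R) → X.Carrier) (k : Fin M) :
    (cover X M π).weight R (fun i => (x i, π ⟨R, x⟩ (x i) k)) = X.weight R x := by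
  unfold cover
  exact if_pos ⟨k, fun i => rfl⟩

/-- The `k`-th copy of a constraint in a cover. -/
def liftConstraint (π : (Σ R : σ.Symbol, (Fin (σ.arity R) → X.Carrier)) → X.Carrier →
    Equiv.Perm (Fin M)) (c : X.Constraint) (k : Fin M) : (cover X M π).Constraint :=
  ⟨⟨c.symb, fun i => (c.tuple i, π c.1 (c.tuple i) k)⟩, by
    have := cover_weight_lift π c.symb c.tuple k
    exact lt_of_lt_of_eq c.2 this.symm⟩

theorem liftConstraint_wt (c : X.Constraint) (k : Fin M) :
    (liftConstraint π c k).wt = c.wt :=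
  cover_weight_lift π c.symb c.tuple k

theorem liftConstraint_bijective (π : (Σ R : σ.Symbol, (Fin (σ.arity R) → X.Carrier)) →
    X.Carrier → Equiv.Perm (Fin M)) :
    Function.Bijective (fun ck : X.Constraint × Fin M => liftConstraint π ck.1 ck.2) := by
  constructor
  · rintro ⟨⟨⟨R, x⟩, hx⟩, k⟩ ⟨⟨⟨R', x'⟩, hx'⟩, k'⟩ h
    have h1 := congrArg Subtype.val h
    obtain rfl : R = R' := congrArg Sigma.fst h1
    have h2 := eq_of_heq (Sigma.mk.inj h1).2
    obtain rfl : x = x' := funext fun i => congrArg Prod.fst (congrFun h2 i)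
    have h3 : k = k' := (π ⟨R, x⟩ _).injective
      (congrArg Prod.snd (congrFun h2 ⟨0, σ.arity_pos R⟩))
    rw [h3]
  · rintro ⟨⟨R, y⟩, hy⟩
    change 0 < (cover X M π).weight R y at hy
    have hk : ∃ k, ∀ i, (y i).2 = π ⟨R, fun i => (y i).1⟩ (y i).1 k := by
      by_contra hne
      refine hy.ne' ?_
      unfold cover
      exact if_neg hne
    obtain ⟨k, hk⟩ := hk
    have hyk : y = fun i => ((y i).1, π ⟨R, fun i => (y i).1⟩ (y i).1 k) :=
      funext fun i => Prod.ext rfl (hk i)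
    refine ⟨⟨⟨⟨R, fun i => (y i).1⟩, ?_⟩, k⟩, ?_⟩
    · have h4 := cover_weight_lift π R (fun i => (y i).1) k
      rw [← hyk] at h4
      exact lt_of_lt_of_eq hy h4
    · exact Subtype.ext (congrArg (Sigma.mk R) hyk.symm)

theorem val_cover (A : ValuedStructure.{w, u} σ) (h : (cover X M π).Carrier → A.Carrier) :
    val (cover X M π) A h = ∑ c : X.Constraint, ∑ k : Fin M,
      ((c.wt : ℚ) : WithTop ℚ) *
        A.rel c.symb (fun i => h (c.tuple i, π c.1 (c.tuple i) k)) := by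
  rw [val_eq_sum_constraint, ← Fintype.sum_prod_type']
  symm
  refine Fintype.sum_bijective _ (liftConstraint_bijective π) _ _ ?_
  rintro ⟨c, k⟩
  rw [liftConstraint_wt]
  rfl

theorem edgeLabel_cover (x : X.Carrier) (c : X.Constraint) (k : Fin M) :
    edgeLabel (cover X M π) (x, π c.1 x k) (liftConstraint π c k) = edgeLabel X x c := by
  have hS : {i | (liftConstraint π c k).tuple i = (x, π c.1 x k)} = {i | c.tuple i = x} := by
    ext i
    change (c.tuple i, π c.1 (c.tuple i) k) = (x, π c.1 x k) ↔ c.tuple i = x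
    constructor
    · exact fun h => congrArg Prod.fst h
    · rintro rfl
      rfl
  unfold edgeLabel
  rw [hS, liftConstraint_wt]
  rfl

/-- A cover looks locally like its base, so that copies have the iterated degrees of the originals.
-/
theorem iteratedDegreeAt_cover (j : ℕ) :
    (∀ x k, iteratedDegreeAt (cover X M π) j (.inl (x, k)) = iteratedDegreeAt X j (.inl x)) ∧
    (∀ c k, iteratedDegreeAt (cover X M π) j (.inr (liftConstraint π c k)) =
      iteratedDegreeAt X j (.inr c)) := by
  classical
  induction j with
  | zero => exact ⟨fun _ _ => rfl, fun _ _ => rfl⟩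
  | succ j ih =>
    constructor
    · intro x k
      simp only [iteratedDegreeAt]
      symm
      -- The copy of `c` at `(x, k)` is the one whose number is sent to `k` by the permutation.
      refine Multiset.map_eq_map_of_bij_of_nodup _ _ (Finset.nodup _) (Finset.nodup _)
        (fun c _ => liftConstraint π c ((π c.1 x).symm k)) ?_ ?_ ?_ ?_
      · intro c hc
        simp only [Finset.mem_val, Finset.mem_filter, Finset.mem_univ, true_and] at hc ⊢
        obtain ⟨i, rfl⟩ := hc
        refine ⟨i, ?_⟩
        change (c.tuple i, π c.1 (c.tuple i) _) = _
        rw [Equiv.apply_symm_apply]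
      · intro c _ c' _ h
        exact congrArg Prod.fst (liftConstraint_bijective π |>.1
          (a₁ := (c, (π c.1 x).symm k)) (a₂ := (c', (π c'.1 x).symm k)) h)
      · intro c' hc'
        obtain ⟨⟨c, l⟩, rfl⟩ := (liftConstraint_bijective π).2 c'
        simp only [Finset.mem_val, Finset.mem_filter, Finset.mem_univ, true_and] at hc'
        obtain ⟨i, hi⟩ := hc'
        change (c.tuple i, π c.1 (c.tuple i) l) = (x, k) at hi
        obtain ⟨rfl, rfl⟩ := Prod.mk.inj hi
        refine ⟨c, ?_, ?_⟩
        · simp only [Finset.mem_val, Finset.mem_filter, Finset.mem_univ, true_and]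
          exact ⟨i, rfl⟩
        · simp
      · intro c hc
        refine Prod.ext ?_ (ih.2 _ _).symm
        have := edgeLabel_cover (π := π) x c ((π c.1 x).symm k)
        rw [Equiv.apply_symm_apply] at this
        exact this.symm
    · intro c k
      simp only [iteratedDegreeAt]
      symm
      refine Multiset.map_eq_map_of_bij_of_nodup _ _ (Finset.nodup _) (Finset.nodup _)
        (fun x _ => (x, π c.1 x k)) ?_ ?_ ?_ ?_
      · intro x hx
        simp only [Finset.mem_val, Finset.mem_filter, Finset.mem_univ, true_and] at hx
        obtain ⟨i, rfl⟩ := hx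
        exact Finset.mem_filter.mpr ⟨Finset.mem_univ _, i, rfl⟩
      · intro x _ x' _ h
        exact congrArg Prod.fst h
      · intro y hy
        simp only [Finset.mem_val, Finset.mem_filter, Finset.mem_univ, true_and] at hy
        obtain ⟨i, rfl⟩ := hy
        exact ⟨c.tuple i, Finset.mem_filter.mpr ⟨Finset.mem_univ _, i, rfl⟩, rfl⟩
      · intro x _
        exact Prod.ext (edgeLabel_cover x c k).symm (ih.1 _ _).symm

theorem degreeSequence_cover :
    degreeSequence (cover X M π) =
      (Finset.univ : Finset ((X.Carrier × Fin M) ⊕ (X.Constraint × Fin M))).val.map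
        (Sum.elim (fun y => iteratedDegree X (.inl y.1)) (fun y => iteratedDegree X (.inr y.1))) := by
  symm
  refine Multiset.map_eq_map_of_bij_of_nodup _ _ (Finset.nodup _) (Finset.nodup _)
    (fun v _ => Sum.map id (fun ck : X.Constraint × Fin M => liftConstraint π ck.1 ck.2) v)
    ?_ ?_ ?_ ?_
  · intro v _
    exact Finset.mem_univ _
  · intro v _ v' _ h
    exact Function.injective_id.sumMap (liftConstraint_bijective π).1 h
  · intro v _
    obtain ⟨v', hv'⟩ := Function.surjective_id.sumMap (liftConstraint_bijective π).2 v
    exact ⟨v', Finset.mem_univ _, hv'⟩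
  · rintro (⟨x, k⟩ | ⟨c, k⟩) _
    · exact funext fun j => ((iteratedDegreeAt_cover j).1 x k).symm
    · exact funext fun j => ((iteratedDegreeAt_cover j).2 c k).symm

theorem wlEquiv_cover (X : InputStructure σ) (M : ℕ)
    (π ρ : (Σ R : σ.Symbol, (Fin (σ.arity R) → X.Carrier)) → X.Carrier → Equiv.Perm (Fin M)) :
    WLEquiv (cover X M π) (cover X M ρ) :=
  degreeSequence_cover.trans degreeSequence_cover.symm

/-- The cover with trivial permutations is a disjoint union of `M` copies of `X`. -/
theorem nsmul_opt_le_opt_cover_one (B : ValuedStructure.{w, v} σ) :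
    M • opt X B ≤ opt (cover X M (fun _ _ => 1)) B := by
  refine Finset.le_inf fun h _ => ?_
  rw [val_cover, Finset.sum_comm]
  calc M • opt X B = ∑ _k : Fin M, opt X B := by simp
    _ ≤ _ := Finset.sum_le_sum fun k _ => ?_
  refine (opt_le_val X B (fun x => h (x, k))).trans (le_of_eq ?_)
  rw [val_eq_sum_constraint]
  rfl

end Cover

/-! ### Rounding a rational solution to a labelling of a cover -/

theorem exists_common_denominator {ι : Type*} [Finite ι] (f : ι → ℚ) (hf : ∀ i, 0 ≤ f i) :
    ∃ M : ℕ, 0 < M ∧ ∀ i, ∃ n : ℕ, (n : ℚ) = M * f i := by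
  have := Fintype.ofFinite ι
  refine ⟨∏ i, (f i).den, Finset.prod_pos fun i _ => (f i).den_pos, fun i => ?_⟩
  obtain ⟨m, hm⟩ := Finset.dvd_prod_of_mem (fun i => (f i).den) (Finset.mem_univ i)
  refine ⟨m * (f i).num.natAbs, ?_⟩
  have h1 : (((f i).num.natAbs : ℤ) : ℚ) = (f i).num := by
    rw [Int.natAbs_of_nonneg (Rat.num_nonneg.mpr (hf i))]
  rw [hm]
  push_cast
  rw [Int.cast_natCast] at h1
  have h2 := Rat.den_mul_eq_num (f i)
  rw [mul_assoc, mul_left_comm, h2, h1]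

theorem exists_fun_card_fiber {α : Type*} [Fintype α] [DecidableEq α] (M : ℕ) (f : α → ℕ)
    (hf : ∑ a, f a = M) : ∃ T : Fin M → α, ∀ a, Fintype.card {k // T k = a} = f a := by
  have e : Fin M ≃ Σ a, Fin (f a) := Fintype.equivOfCardEq (by simp [hf])
  refine ⟨fun k => (e k).1, fun a => ?_⟩
  have e' : {k // (e k).1 = a} ≃ Fin (f a) :=
    (e.subtypeEquiv (q := fun s => s.1 = a) (fun _ => Iff.rfl)).trans (Equiv.sigmaSubtype a)
  rw [Fintype.card_congr e', Fintype.card_fin]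

theorem exists_perm_comp_eq {κ α : Type*} [Fintype κ] [DecidableEq α] (L T : κ → α)
    (h : ∀ a, Fintype.card {k // T k = a} = Fintype.card {k // L k = a}) :
    ∃ π : Equiv.Perm κ, ∀ k, L (π k) = T k := by
  refine ⟨Equiv.ofFiberEquiv (f := T) (g := L) fun a => Fintype.equivOfCardEq (h a), fun k => ?_⟩
  exact Equiv.ofFiberEquiv_map _ _

open Classical in
theorem SAAssignment.IsFeasible.sum_onCon {X : InputStructure σ} {A : ValuedStructure.{w, u} σ}
    {p : SAAssignment X A} (hp : p.IsFeasible) (c : X.Constraint) : ∑ t, p.onCon c t = 1 := by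
  have i : Fin (σ.arity c.symb) := ⟨0, σ.arity_pos _⟩
  rw [← hp.sum_onVar (c.tuple i), ← Finset.sum_fiberwise Finset.univ (fun t => t i)]
  exact Finset.sum_congr rfl fun a _ => (hp.marginal c i a).symm

open Classical in
/-- A feasible rational solution is realised, up to the factor `M`, by a labelling of some `M`-fold
cover. -/
theorem SAAssignment.IsFeasible.exists_cover {X : InputStructure σ}
    {A : ValuedStructure.{w, u} σ} {p : SAAssignment X A} (hp : p.IsFeasible) :
    ∃ M : ℕ, 0 < M ∧ ∃ π, opt (cover X M π) A ≤ M • p.objective := by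
  obtain ⟨M, hM, hn⟩ := exists_common_denominator
    (Sum.elim (fun y : X.Carrier × A.Carrier => p.onVar y.1 y.2)
      (fun y : Σ c : X.Constraint, (Fin (σ.arity c.symb) → A.Carrier) => p.onCon y.1 y.2))
    (by rintro (y | y); exacts [(hp.onVar_mem _ _).1, (hp.onCon_mem _ _).1])
  choose n hn using hn
  have hvar : ∀ x, ∃ L : Fin M → A.Carrier, ∀ a,
      (Fintype.card {k // L k = a} : ℚ) = M * p.onVar x a := by
    intro x
    obtain ⟨L, hL⟩ := exists_fun_card_fiber M (fun a => n (.inl (x, a))) (by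
      have : ((∑ a, n (.inl (x, a)) : ℕ) : ℚ) = M := by
        push_cast
        simp only [hn, Sum.elim_inl, ← Finset.mul_sum, hp.sum_onVar, mul_one]
      exact_mod_cast this)
    exact ⟨L, fun a => by rw [hL, hn]; rfl⟩
  have hcon : ∀ c : X.Constraint, ∃ T : Fin M → (Fin (σ.arity c.symb) → A.Carrier), ∀ t,
      (Fintype.card {k // T k = t} : ℚ) = M * p.onCon c t := by
    intro c
    obtain ⟨T, hT⟩ := exists_fun_card_fiber M (fun t => n (.inr ⟨c, t⟩)) (by
      have : ((∑ t, n (.inr ⟨c, t⟩) : ℕ) : ℚ) = M := by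
        push_cast
        simp only [hn, Sum.elim_inr, ← Finset.mul_sum, hp.sum_onCon, mul_one]
      exact_mod_cast this)
    exact ⟨T, fun a => by rw [hT, hn]; rfl⟩
  choose L hL using hvar
  choose T hT using hcon
  have hrep : ∀ (c : X.Constraint) k i j, c.tuple i = c.tuple j → T c k i = T c k j := by
    intro c k i j hij
    by_contra hne
    have h0 := hT c (T c k)
    rw [hp.repetition c _ i j hij hne, mul_zero] at h0
    have : 0 < Fintype.card {k' // T c k' = T c k} := Fintype.card_pos_iff.mpr ⟨⟨k, rfl⟩⟩
    exact this.ne' (by exact_mod_cast h0)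
  have hperm : ∀ (c : X.Constraint) (x : X.Carrier), ∃ π : Equiv.Perm (Fin M),
      ∀ i, c.tuple i = x → ∀ k, L x (π k) = T c k i := by
    intro c x
    by_cases hx : ∃ i, c.tuple i = x
    · obtain ⟨i, rfl⟩ := hx
      obtain ⟨π, hπ⟩ := exists_perm_comp_eq (L (c.tuple i)) (fun k => T c k i) (by
        intro a
        have h1 : Fintype.card {k // T c k i = a} =
            ∑ t : Fin (σ.arity c.symb) → A.Carrier with t i = a,
              Fintype.card {k // T c k = t} := by
          simp only [Fintype.card_subtype]
          rw [Finset.card_eq_sum_card_fiberwise (f := T c)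
            (t := Finset.univ.filter fun t => t i = a)]
          · refine Finset.sum_congr rfl fun t ht => ?_
            congr 1
            ext k
            simp only [Finset.mem_filter, Finset.mem_univ, true_and] at ht ⊢
            exact ⟨fun h => h.2, fun h => ⟨by rw [h, ht], h⟩⟩
          · intro k hk
            simpa using hk
        have h2 : (Fintype.card {k // T c k i = a} : ℚ) =
            Fintype.card {k // L (c.tuple i) k = a} := by
          rw [h1, hL, hp.marginal c i a, Finset.mul_sum]
          push_cast
          exact Finset.sum_congr rfl fun t _ => hT c t
        exact_mod_cast h2)
      exact ⟨π, fun j hj k => (hπ k).trans (hrep c k i j hj.symm)⟩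
    · exact ⟨1, fun i hi => absurd ⟨i, hi⟩ hx⟩
  choose π hπ using hperm
  -- The permutations attached to tuples of weight `0` are irrelevant.
  let π' : (Σ R : σ.Symbol, (Fin (σ.arity R) → X.Carrier)) → X.Carrier → Equiv.Perm (Fin M) :=
    fun s x => if hs : 0 < X.weight s.1 s.2 then π ⟨s, hs⟩ x else 1
  have hπ' : ∀ (c : X.Constraint) x, π' c.1 x = π c x := fun c x => dif_pos c.2
  refine ⟨M, hM, π', (opt_le_val _ A fun y : X.Carrier × Fin M => L y.1 y.2).trans
    (le_of_eq ((val_cover A _).trans ?_))⟩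
  unfold SAAssignment.objective
  rw [Finset.smul_sum]
  refine Finset.sum_congr rfl fun c _ => ?_
  have h3 : ∀ k, (fun i => L (c.tuple i) (π' c.1 (c.tuple i) k)) = T c k := fun k =>
    funext fun i => by rw [hπ']; exact hπ c _ i rfl k
  rw [Finset.smul_sum]
  calc _ = ∑ k, ((c.wt : ℚ) : WithTop ℚ) * A.rel c.symb (T c k) :=
        Finset.sum_congr rfl fun k _ => by rw [← h3 k]
    _ = ∑ t, ∑ k with T c k = t, ((c.wt : ℚ) : WithTop ℚ) * A.rel c.symb (T c k) :=
        (Finset.sum_fiberwise _ _ _).symm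
    _ = _ := Finset.sum_congr rfl fun t _ => ?_
  rw [Finset.sum_congr rfl (g := fun _ => ((c.wt : ℚ) : WithTop ℚ) * A.rel c.symb t)
    (fun k hk => by rw [(Finset.mem_filter.mp hk).2]), Finset.sum_const,
    ← Fintype.card_subtype]
  have h4 := hT c t
  cases hr : A.rel c.symb t using WithTop.recTopCoe with
  | top =>
    rw [hp.infinite_cost c t hr] at h4 ⊢
    have h5 : Fintype.card {k // T c k = t} = 0 := by
      rw [mul_zero] at h4
      exact_mod_cast h4
    simp [h5]
  | coe r =>
    rw [← WithTop.coe_mul, ← WithTop.coe_mul, ← WithTop.coe_mul, ← WithTop.coe_nsmul,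
      ← WithTop.coe_nsmul, nsmul_eq_mul, nsmul_eq_mul, h4]
    congr 1
    ring

theorem ClosedUnderWL.saDecides {A : ValuedStructure.{w, u} σ} {B : ValuedStructure.{w, v} σ}
    (h : ClosedUnderWL A B) : SADecides A B := by
  intro X
  refine le_sInf ?_
  rintro _ ⟨p, hp, rfl⟩
  rw [toEReal_le_toEReal]
  obtain ⟨M, hM, π, hle⟩ := hp.exists_cover
  exact le_of_nsmul_le_nsmul_withTop hM
    ((nsmul_opt_le_opt_cover_one B).trans ((h _ _ (wlEquiv_cover X M π _)).trans hle))

/-! ### Stabilisation of iterated degrees -/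

open Classical in
/-- Recovers the `j`-th iterated degree of a node from the `(j + 1)`-st. At level `0` constraints
are the nodes with a neighbour of variable type, because arities are positive. -/
def truncateDegree : ∀ j : ℕ, DegreeType σ (j + 1) → DegreeType σ j
  | 0, m => ULift.up (decide (∃ p : Label σ × DegreeType σ 0, Membership.mem
      (γ := Multiset (Label σ × DegreeType σ 0)) m p ∧ p.2 = ULift.up false))
  | j + 1, m => Multiset.map (fun p : Label σ × DegreeType σ (j + 1) =>
      (p.1, truncateDegree j p.2)) m

theorem truncateDegree_iteratedDegreeAt (X : InputStructure σ) (j : ℕ)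
    (n : X.Carrier ⊕ X.Constraint) :
    truncateDegree j (iteratedDegreeAt X (j + 1) n) = iteratedDegreeAt X j n := by
  classical
  induction j generalizing n with
  | zero =>
    rcases n with x | c
    · refine congrArg ULift.up (decide_eq_false ?_)
      rintro ⟨p, hp, h⟩
      obtain ⟨c, _, rfl⟩ := Multiset.mem_map.mp hp
      exact Bool.noConfusion (congrArg ULift.down h)
    · refine congrArg ULift.up (decide_eq_true ⟨_, Multiset.mem_map_of_mem _
        (Finset.mem_filter.mpr ⟨Finset.mem_univ _, ⟨0, σ.arity_pos c.symb⟩, rfl⟩), rfl⟩)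
  | succ j ih =>
    rcases n with x | c
    · refine (Multiset.map_map _ _ _).trans (Multiset.map_congr rfl fun c _ => ?_)
      exact Prod.ext rfl (ih (.inr c))
    · refine (Multiset.map_map _ _ _).trans (Multiset.map_congr rfl fun x _ => ?_)
      exact Prod.ext rfl (ih (.inl x))

/-- If equality at each level implies equality at all earlier levels, finitely many sequences are
separated by a single level. -/
theorem exists_level_separating {V : Type*} [Finite V] {κ : ℕ → Type*} (F : V → ∀ j, κ j)
    (hF : ∀ v v' j, F v (j + 1) = F v' (j + 1) → F v j = F v' j) :
    ∃ N, ∀ v v', F v N = F v' N → F v = F v' := by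
  have hmono : ∀ v v' i j, i ≤ j → F v j = F v' j → F v i = F v' i := by
    intro v v' i j hij
    induction hij with
    | refl => exact id
    | step _ ih => exact fun h => ih (hF _ _ _ h)
  have hev : ∀ᶠ N in Filter.atTop, ∀ p : V × V, F p.1 N = F p.2 N → F p.1 = F p.2 := by
    refine Filter.eventually_all.mpr fun p => ?_
    by_cases h : F p.1 = F p.2
    · exact Filter.Eventually.of_forall fun _ _ => h
    · obtain ⟨j, hj⟩ := Function.ne_iff.mp h
      filter_upwards [Filter.eventually_ge_atTop j] with N hN hN'
      exact absurd (hmono _ _ _ _ hN hN') hj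
  obtain ⟨N, hN⟩ := hev.exists
  exact ⟨N, fun v v' => hN (v, v')⟩

open Classical in
/-- The multiset of the pairs (edge label, iterated degree of the neighbour) at a node, with the
whole sequence of iterated degrees in place of a single level. -/
def neighborhood (X : InputStructure σ) :
    X.Carrier ⊕ X.Constraint → Multiset (Label σ × ∀ j : ℕ, DegreeType σ j)
  | .inl x =>
      ((Finset.univ : Finset X.Constraint).filter (fun c => x ∈ Set.range c.tuple)).val.map
        (fun c => (edgeLabel X x c, iteratedDegree X (.inr c)))
  | .inr c =>
      ((Finset.univ : Finset X.Carrier).filter (fun x => x ∈ Set.range c.tuple)).val.map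
        (fun x => (edgeLabel X x c, iteratedDegree X (.inl x)))

theorem map_iteratedDegreeAt_eq_neighborhood (X : InputStructure σ) {N : ℕ}
    {Φ : DegreeType σ N → ∀ j, DegreeType σ j}
    (hΦ : ∀ n, Φ (iteratedDegreeAt X N n) = iteratedDegree X n) (n : X.Carrier ⊕ X.Constraint) :
    Multiset.map (fun p : Label σ × DegreeType σ N => (p.1, Φ p.2))
      (iteratedDegreeAt X (N + 1) n) = neighborhood X n := by
  rcases n with x | c
  · refine (Multiset.map_map _ _ _).trans (Multiset.map_congr rfl fun c _ => ?_)
    exact Prod.ext rfl (hΦ (.inr c))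
  · refine (Multiset.map_map _ _ _).trans (Multiset.map_congr rfl fun x _ => ?_)
    exact Prod.ext rfl (hΦ (.inl x))

theorem neighborhood_eq_of_iteratedDegree_eq {X₁ X₂ : InputStructure σ}
    {n₁ : X₁.Carrier ⊕ X₁.Constraint} {n₂ : X₂.Carrier ⊕ X₂.Constraint}
    (h : iteratedDegree X₁ n₁ = iteratedDegree X₂ n₂) :
    neighborhood X₁ n₁ = neighborhood X₂ n₂ := by
  let F : (X₁.Carrier ⊕ X₁.Constraint) ⊕ (X₂.Carrier ⊕ X₂.Constraint) → ∀ j, DegreeType σ j :=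
    Sum.elim (iteratedDegree X₁) (iteratedDegree X₂)
  have htr : ∀ v j, truncateDegree j (F v (j + 1)) = F v j := by
    rintro (n | n) j
    · exact truncateDegree_iteratedDegreeAt X₁ j n
    · exact truncateDegree_iteratedDegreeAt X₂ j n
  obtain ⟨N, hN⟩ := exists_level_separating F fun v v' j hj => by
    rw [← htr v, ← htr v', hj]
  have hfac : Function.FactorsThrough F (fun v => F v N) := fun v v' hv => hN v v' hv
  let Φ : DegreeType σ N → ∀ j, DegreeType σ j :=
    Function.extend (fun v => F v N) F (fun _ => F (.inl n₁))
  have hΦ : ∀ v, Φ (F v N) = F v := fun v => hfac.extend_apply _ v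
  rw [← map_iteratedDegreeAt_eq_neighborhood X₁ (Φ := Φ) (fun n => hΦ (.inl n)),
    ← map_iteratedDegreeAt_eq_neighborhood X₂ (Φ := Φ) (fun n => hΦ (.inr n))]
  exact congrArg _ (congrFun h (N + 1))

/-- A constraint with the iterated degree of `c` has the same symbol and weight as `c`, the same
coincidences between its entries, and entries of the same iterated degrees. -/
theorem exists_tuple_of_iteratedDegree_eq {X₁ X₂ : InputStructure σ} {c : X₂.Constraint}
    {c' : X₁.Constraint} (h : iteratedDegree X₁ (.inr c') = iteratedDegree X₂ (.inr c)) :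
    ∃ (y : Fin (σ.arity c.symb) → X₁.Carrier) (hy : 0 < X₁.weight c.symb y),
      c' = ⟨⟨c.symb, y⟩, hy⟩ ∧ X₁.weight c.symb y = c.wt ∧
        ∀ i, {j | y j = y i} = {j | c.tuple j = c.tuple i} ∧
          iteratedDegree X₁ (.inl (y i)) = iteratedDegree X₂ (.inl (c.tuple i)) := by
  have hn := neighborhood_eq_of_iteratedDegree_eq h
  have key : ∀ i, ∃ x ∈ Set.range c'.tuple, edgeLabel X₁ x c' = edgeLabel X₂ (c.tuple i) c ∧
      iteratedDegree X₁ (.inl x) = iteratedDegree X₂ (.inl (c.tuple i)) := by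
    classical
    intro i
    have hmem : (edgeLabel X₂ (c.tuple i) c, iteratedDegree X₂ (.inl (c.tuple i))) ∈
        neighborhood X₁ (.inr c') := by
      rw [hn]
      exact Multiset.mem_map.mpr ⟨c.tuple i,
        Finset.mem_filter.mpr ⟨Finset.mem_univ _, i, rfl⟩, rfl⟩
    obtain ⟨x, hx, he⟩ := Multiset.mem_map.mp hmem
    exact ⟨x, (Finset.mem_filter.mp hx).2, congrArg Prod.fst he, congrArg Prod.snd he⟩
  obtain ⟨⟨R, y⟩, hy⟩ := c'
  obtain ⟨⟨R', z⟩, hz⟩ := c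
  obtain ⟨_, _, h0, _⟩ := key ⟨0, σ.arity_pos _⟩
  obtain rfl : R = R' := congrArg Sigma.fst h0
  refine ⟨y, hy, rfl, congrArg Prod.snd (eq_of_heq (Sigma.mk.inj h0).2), fun i => ?_⟩
  obtain ⟨x, _, hl, hx⟩ := key i
  have hS : {j | y j = x} = {j | z j = z i} :=
    congrArg Prod.fst (eq_of_heq (Sigma.mk.inj hl).2)
  have hi : y i = x := by
    have : i ∈ {j | z j = z i} := rfl
    rwa [← hS] at this
  subst hi
  exact ⟨hS, hx⟩

/-! ### Averaging over classes of equal iterated degree -/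

/-- Averaging `φ` over the fibres of `f` and summing along `g` recovers the sum of `φ`, provided
`f` and `g` have the same multiset of values. -/
theorem sum_average_fiber {ι₁ ι₂ κ : Type*} [Fintype ι₁] [Fintype ι₂] [DecidableEq κ]
    (f : ι₁ → κ) (g : ι₂ → κ)
    (h : (Finset.univ : Finset ι₁).val.map f = (Finset.univ : Finset ι₂).val.map g)
    (φ : ι₁ → ℚ) :
    ∑ c, (∑ c' with f c' = g c, φ c') / ((Finset.univ.filter fun c' => f c' = g c).card : ℚ) =
      ∑ c', φ c' := by
  have hcard : ∀ k, (Finset.univ.filter fun c => f c = k).card =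
      (Finset.univ.filter fun c => g c = k).card := by
    intro k
    have := congrArg (Multiset.count k) h
    rw [Multiset.count_map, Multiset.count_map] at this
    simpa only [Finset.card, Finset.filter_val, eq_comm] using this
  simp only [Finset.sum_div, Finset.sum_filter]
  rw [Finset.sum_comm]
  refine Finset.sum_congr rfl fun c' _ => ?_
  have hpos : 0 < (Finset.univ.filter fun c => g c = f c').card := by
    rw [← hcard]
    exact Finset.card_pos.mpr ⟨c', by simp⟩
  rw [Finset.sum_congr rfl (g := fun c =>
    if g c = f c' then φ c' / ((Finset.univ.filter fun c => g c = f c').card : ℚ) else 0)]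
  · rw [← Finset.sum_filter, Finset.sum_const, nsmul_eq_mul]
    field_simp
  · intro c _
    by_cases hc : g c = f c'
    · rw [if_pos hc, if_pos hc.symm, hcard, hc]
    · rw [if_neg hc, if_neg (Ne.symm hc), zero_div]

theorem degreeSequence_eq_add (X : InputStructure σ) :
    degreeSequence X =
      (Finset.univ : Finset X.Carrier).val.map (fun x => iteratedDegree X (.inl x)) +
      (Finset.univ : Finset X.Constraint).val.map (fun c => iteratedDegree X (.inr c)) := by
  unfold degreeSequence
  rw [← Finset.univ_disjSum_univ, Finset.val_disjSum, Multiset.disjSum, Multiset.map_add,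
    Multiset.map_map, Multiset.map_map]
  rfl

theorem eq_and_eq_of_add_eq_add {α : Type*} (P : α → Prop) {s₁ s₂ t₁ t₂ : Multiset α}
    (h : s₁ + t₁ = s₂ + t₂) (hs₁ : ∀ a ∈ s₁, P a) (hs₂ : ∀ a ∈ s₂, P a)
    (ht₁ : ∀ a ∈ t₁, ¬ P a) (ht₂ : ∀ a ∈ t₂, ¬ P a) : s₁ = s₂ ∧ t₁ = t₂ := by
  classical
  have hs : s₁ = s₂ := by
    have := congrArg (Multiset.filter P) h
    rwa [Multiset.filter_add, Multiset.filter_add, Multiset.filter_eq_self.mpr hs₁,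
      Multiset.filter_eq_self.mpr hs₂, Multiset.filter_eq_nil.mpr ht₁,
      Multiset.filter_eq_nil.mpr ht₂, add_zero, add_zero] at this
  exact ⟨hs, by rwa [hs, add_right_inj] at h⟩

theorem WLEquiv.map_iteratedDegree {X₁ X₂ : InputStructure σ} (h : WLEquiv X₁ X₂) :
    (Finset.univ : Finset X₁.Carrier).val.map (fun x => iteratedDegree X₁ (.inl x)) =
      (Finset.univ : Finset X₂.Carrier).val.map (fun x => iteratedDegree X₂ (.inl x)) ∧
    (Finset.univ : Finset X₁.Constraint).val.map (fun c => iteratedDegree X₁ (.inr c)) =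
      (Finset.univ : Finset X₂.Constraint).val.map (fun c => iteratedDegree X₂ (.inr c)) := by
  have hvar : ∀ X : InputStructure σ, ∀ d ∈ (Finset.univ : Finset X.Carrier).val.map
      (fun x => iteratedDegree X (.inl x)), d 0 = ULift.up false := by
    intro X d hd
    obtain ⟨x, _, rfl⟩ := Multiset.mem_map.mp hd
    rfl
  have hcon : ∀ X : InputStructure σ, ∀ d ∈ (Finset.univ : Finset X.Constraint).val.map
      (fun c => iteratedDegree X (.inr c)), ¬ d 0 = ULift.up false := by
    intro X d hd
    obtain ⟨c, _, rfl⟩ := Multiset.mem_map.mp hd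
    exact fun h => Bool.noConfusion (congrArg ULift.down h)
  unfold WLEquiv at h
  rw [degreeSequence_eq_add, degreeSequence_eq_add] at h
  exact eq_and_eq_of_add_eq_add _ h (hvar X₁) (hvar X₂) (hcon X₁) (hcon X₂)

theorem exists_eq_of_map_univ_eq {ι₁ ι₂ κ : Type*} [Fintype ι₁] [Fintype ι₂]
    {f : ι₁ → κ} {g : ι₂ → κ}
    (h : (Finset.univ : Finset ι₁).val.map f = (Finset.univ : Finset ι₂).val.map g) (b : ι₂) :
    ∃ a, f a = g b := by
  have hb : g b ∈ (Finset.univ : Finset ι₁).val.map f := by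
    rw [h]
    exact Multiset.mem_map_of_mem g (Finset.mem_univ b)
  obtain ⟨a, _, ha⟩ := Multiset.mem_map.mp hb
  exact ⟨a, ha⟩

open Classical in
/-- The variables of `X` with iterated degree `d`. -/
def varClass (X : InputStructure σ) (d : ∀ j, DegreeType σ j) : Finset X.Carrier :=
  Finset.univ.filter fun x => iteratedDegree X (.inl x) = d

open Classical in
/-- The constraints of `X` with iterated degree `d`. -/
def conClass (X : InputStructure σ) (d : ∀ j, DegreeType σ j) : Finset X.Constraint :=
  Finset.univ.filter fun c => iteratedDegree X (.inr c) = d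

theorem mem_varClass {X : InputStructure σ} {d : ∀ j, DegreeType σ j} {x : X.Carrier} :
    x ∈ varClass X d ↔ iteratedDegree X (.inl x) = d := by
  simp [varClass]

theorem mem_conClass {X : InputStructure σ} {d : ∀ j, DegreeType σ j} {c : X.Constraint} :
    c ∈ conClass X d ↔ iteratedDegree X (.inr c) = d := by
  simp [conClass]

theorem edgeLabel_eq_iff {X₁ X₂ : InputStructure σ} {c : X₂.Constraint}
    {y : Fin (σ.arity c.symb) → X₁.Carrier} (hy : 0 < X₁.weight c.symb y)
    (hwt : X₁.weight c.symb y = c.wt) {i : Fin (σ.arity c.symb)}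
    (hS : {j | y j = y i} = {j | c.tuple j = c.tuple i}) (x : X₁.Carrier) :
    edgeLabel X₁ x ⟨⟨c.symb, y⟩, hy⟩ = edgeLabel X₂ (c.tuple i) c ↔ y i = x := by
  constructor
  · intro h
    have h1 : {j | y j = x} = {j | c.tuple j = c.tuple i} :=
      congrArg Prod.fst (eq_of_heq (Sigma.mk.inj h).2)
    have hi : i ∈ {j | c.tuple j = c.tuple i} := rfl
    rwa [← h1] at hi
  · rintro rfl
    exact congrArg (Sigma.mk c.symb) (Prod.ext hS hwt)

open Classical in
/-- Since the iterated degree of a variable determines the number of constraints of each class that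
contain it at given positions, all variables in the class of the `i`-th entry of `c` are the `i`-th
entry of equally many constraints in the class of `c`. -/
theorem exists_card_conClass_filter {X₁ X₂ : InputStructure σ} (c : X₂.Constraint)
    (i : Fin (σ.arity c.symb)) : ∃ m : ℕ, ∀ P : X₁.Carrier → Prop,
      ((conClass X₁ (iteratedDegree X₂ (.inr c))).filter fun c' =>
        ∃ x, edgeLabel X₁ x c' = edgeLabel X₂ (c.tuple i) c ∧ P x).card =
      ((varClass X₁ (iteratedDegree X₂ (.inl (c.tuple i)))).filter P).card * m := by
  set l := edgeLabel X₂ (c.tuple i) c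
  refine ⟨Multiset.count (l, iteratedDegree X₂ (.inr c))
    (neighborhood X₂ (.inl (c.tuple i))), fun P => ?_⟩
  have hU : (conClass X₁ (iteratedDegree X₂ (.inr c))).filter (fun c' =>
        ∃ x, edgeLabel X₁ x c' = l ∧ P x) =
      ((varClass X₁ (iteratedDegree X₂ (.inl (c.tuple i)))).filter P).biUnion fun x =>
        (conClass X₁ (iteratedDegree X₂ (.inr c))).filter fun c' => edgeLabel X₁ x c' = l := by
    ext c'
    simp only [Finset.mem_filter, Finset.mem_biUnion, mem_conClass, mem_varClass]
    constructor
    · rintro ⟨hc', x, hx, hP⟩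
      obtain ⟨y, hy, rfl, hwt, hi⟩ := exists_tuple_of_iteratedDegree_eq hc'
      have hyx := (edgeLabel_eq_iff hy hwt (hi i).1 x).mp hx
      subst hyx
      exact ⟨y i, ⟨(hi i).2, hP⟩, hc', hx⟩
    · rintro ⟨x, ⟨_, hP⟩, hc', hx⟩
      exact ⟨hc', x, hx, hP⟩
  rw [hU, Finset.card_biUnion, Finset.sum_const_nat]
  · intro x hx
    have hx' := mem_varClass.mp (Finset.mem_filter.mp hx).1
    rw [← neighborhood_eq_of_iteratedDegree_eq hx', neighborhood, Multiset.count_map,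
      ← Finset.filter_val, Finset.filter_filter]
    refine congrArg Finset.card (Finset.ext fun c' => ?_)
    simp only [Finset.mem_filter, mem_conClass, Finset.mem_univ, true_and, Prod.mk.injEq]
    constructor
    · rintro ⟨hc', hxl⟩
      refine ⟨?_, hxl.symm, hc'.symm⟩
      obtain ⟨y, hy, rfl, hwt, hi⟩ := exists_tuple_of_iteratedDegree_eq hc'
      exact ⟨i, (edgeLabel_eq_iff hy hwt (hi i).1 x).mp hxl⟩
    · rintro ⟨_, hxl, hc'⟩
      exact ⟨hc'.symm, hxl.symm⟩
  · intro x _ x' _ hne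
    refine Finset.disjoint_left.mpr fun c' h h' => hne ?_
    rw [Finset.mem_filter, mem_conClass] at h h'
    obtain ⟨y, hy, rfl, hwt, hi⟩ := exists_tuple_of_iteratedDegree_eq h.1
    exact ((edgeLabel_eq_iff hy hwt (hi i).1 x).mp h.2).symm.trans
      ((edgeLabel_eq_iff hy hwt (hi i).1 x').mp h'.2)

/-- The symbol of a constraint together with the image of its tuple under `h`. -/
def imageTuple {X : InputStructure σ} {A : ValuedStructure.{w, u} σ}
    (h : X.Carrier → A.Carrier) (c : X.Constraint) :
    Σ R : σ.Symbol, (Fin (σ.arity R) → A.Carrier) :=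
  ⟨c.symb, h ∘ c.tuple⟩

open Classical in
/-- The assignment on `X₂` in which every node carries the empirical distribution of `h` on the
class of nodes of `X₁` with the same iterated degree. These classes are non-empty when
`X₁ ≡₁ X₂`; on an empty class the quotients are `0 / 0 = 0`. -/
def averageAssignment {X₁ : InputStructure σ} (X₂ : InputStructure σ)
    {A : ValuedStructure.{w, u} σ} (h : X₁.Carrier → A.Carrier) : SAAssignment X₂ A where
  onVar x a := (((varClass X₁ (iteratedDegree X₂ (.inl x))).filter fun x' => h x' = a).card : ℚ) /
    (varClass X₁ (iteratedDegree X₂ (.inl x))).card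
  onCon c t := (((conClass X₁ (iteratedDegree X₂ (.inr c))).filter fun c' =>
      imageTuple h c' = ⟨c.symb, t⟩).card : ℚ) /
    (conClass X₁ (iteratedDegree X₂ (.inr c))).card

theorem exists_of_averageAssignment_onCon_ne_zero {X₁ X₂ : InputStructure σ}
    {A : ValuedStructure.{w, u} σ} {h : X₁.Carrier → A.Carrier} {c : X₂.Constraint}
    {t : Fin (σ.arity c.symb) → A.Carrier} (ht : (averageAssignment X₂ h).onCon c t ≠ 0) :
    ∃ c' ∈ conClass X₁ (iteratedDegree X₂ (.inr c)), imageTuple h c' = ⟨c.symb, t⟩ := by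
  classical
  by_contra! hne
  refine ht ?_
  unfold averageAssignment
  simp only
  rw [Finset.filter_false_of_mem hne, Finset.card_empty, Nat.cast_zero, zero_div]

theorem card_filter_div_card_mem_Icc {ι : Type*} (s : Finset ι) (P : ι → Prop) [DecidablePred P] :
    ((s.filter P).card : ℚ) / s.card ∈ Set.Icc (0 : ℚ) 1 :=
  ⟨by positivity, div_le_one_of_le₀ (by exact_mod_cast Finset.card_filter_le s P) (by positivity)⟩

theorem averageAssignment_isFeasible {X₁ X₂ : InputStructure σ} (hX : WLEquiv X₁ X₂)
    {A : ValuedStructure.{w, u} σ} {h : X₁.Carrier → A.Carrier}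
    (hh : ∀ c : X₁.Constraint, A.rel c.symb (h ∘ c.tuple) ≠ ⊤) :
    (averageAssignment X₂ h).IsFeasible where
  onVar_mem x a := by
    classical
    exact card_filter_div_card_mem_Icc _ _
  onCon_mem c t := by
    classical
    exact card_filter_div_card_mem_Icc _ _
  sum_onVar x := by
    classical
    obtain ⟨x', hx'⟩ := exists_eq_of_map_univ_eq hX.map_iteratedDegree.1 x
    have hpos : 0 < (varClass X₁ (iteratedDegree X₂ (.inl x))).card :=
      Finset.card_pos.mpr ⟨x', mem_varClass.mpr hx'⟩
    unfold averageAssignment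
    simp only
    rw [← Finset.sum_div, div_eq_one_iff_eq (by exact_mod_cast hpos.ne')]
    exact_mod_cast (Finset.card_eq_sum_card_fiberwise
      (fun x' _ => Finset.mem_coe.mpr (Finset.mem_univ (h x')))).symm
  marginal c i a := by
    classical
    obtain ⟨c', hc'⟩ := exists_eq_of_map_univ_eq hX.map_iteratedDegree.2 c
    have hpos : 0 < (conClass X₁ (iteratedDegree X₂ (.inr c))).card :=
      Finset.card_pos.mpr ⟨c', mem_conClass.mpr hc'⟩
    obtain ⟨m, hm⟩ := exists_card_conClass_filter (X₁ := X₁) c i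
    have hall : ∀ P : X₁.Carrier → Prop, (∀ x, P x) →
        (conClass X₁ (iteratedDegree X₂ (.inr c))).card =
          (varClass X₁ (iteratedDegree X₂ (.inl (c.tuple i)))).card * m := by
      intro P hP
      have := hm P
      rw [Finset.filter_true_of_mem, Finset.filter_true_of_mem (fun x _ => hP x)] at this
      · exact this
      · intro c' hc'
        obtain ⟨y, hy, rfl, hwt, hi⟩ := exists_tuple_of_iteratedDegree_eq (mem_conClass.mp hc')
        exact ⟨y i, (edgeLabel_eq_iff hy hwt (hi i).1 _).mpr rfl, hP _⟩
    replace hall := hall (fun _ => True) fun _ => trivial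
    have hfib : ∑ t : Fin (σ.arity c.symb) → A.Carrier with t i = a,
        ((conClass X₁ (iteratedDegree X₂ (.inr c))).filter fun c' =>
          imageTuple h c' = ⟨c.symb, t⟩).card =
        ((varClass X₁ (iteratedDegree X₂ (.inl (c.tuple i)))).filter fun x => h x = a).card * m := by
      rw [← hm, ← Finset.card_biUnion]
      · refine congrArg Finset.card (Finset.ext fun c' => ?_)
        simp only [Finset.mem_filter, Finset.mem_biUnion, Finset.mem_univ, true_and]
        constructor
        · rintro ⟨t, rfl, hc', ht⟩
          obtain ⟨y, hy, rfl, hwt, hi⟩ := exists_tuple_of_iteratedDegree_eq (mem_conClass.mp hc')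
          refine ⟨hc', y i, (edgeLabel_eq_iff hy hwt (hi i).1 _).mpr rfl, ?_⟩
          exact congrFun (eq_of_heq (Sigma.mk.inj ht).2) i
        · rintro ⟨hc', x, hx, rfl⟩
          obtain ⟨y, hy, rfl, hwt, hi⟩ := exists_tuple_of_iteratedDegree_eq (mem_conClass.mp hc')
          have hyx := (edgeLabel_eq_iff hy hwt (hi i).1 x).mp hx
          exact ⟨h ∘ y, congrArg h hyx, hc', rfl⟩
      · intro t _ t' _ hne
        refine Finset.disjoint_left.mpr fun c' hc hc' => hne ?_
        have h1 := (Finset.mem_filter.mp hc).2.symm.trans (Finset.mem_filter.mp hc').2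
        exact eq_of_heq (Sigma.mk.inj h1).2
    have hm0 : m ≠ 0 := by
      rintro rfl
      rw [hall, mul_zero] at hpos
      exact hpos.false
    unfold averageAssignment
    simp only
    rw [← Finset.sum_div, ← Nat.cast_sum, hfib, hall]
    push_cast
    rw [mul_div_mul_right _ _ (by exact_mod_cast hm0)]
  infinite_cost c t ht := by
    by_contra hne
    obtain ⟨c', _, hc'⟩ := exists_of_averageAssignment_onCon_ne_zero hne
    refine hh c' ?_
    exact (congrArg (fun s : Σ R : σ.Symbol, (Fin (σ.arity R) → A.Carrier) => A.rel s.1 s.2)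
      hc').trans ht
  repetition c t i j hij hne := by
    by_contra hne'
    obtain ⟨c', hc', ht⟩ := exists_of_averageAssignment_onCon_ne_zero hne'
    obtain ⟨y, hy, rfl, hwt, hi⟩ := exists_tuple_of_iteratedDegree_eq (mem_conClass.mp hc')
    have h1 : h ∘ y = t := eq_of_heq (Sigma.mk.inj ht).2
    have h2 : i ∈ {k | y k = y j} := by
      rw [(hi j).1]
      exact hij
    exact hne (by rw [← h1]; exact congrArg h h2)

theorem averageAssignment_objective {X₁ X₂ : InputStructure σ} (hX : WLEquiv X₁ X₂)
    {A : ValuedStructure.{w, u} σ} {h : X₁.Carrier → A.Carrier}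
    (hh : ∀ c : X₁.Constraint, A.rel c.symb (h ∘ c.tuple) ≠ ⊤) :
    (averageAssignment X₂ h).objective = val X₁ A h := by
  classical
  -- All terms are finite, so that both sides can be computed in `ℚ`.
  let r : (Σ R : σ.Symbol, (Fin (σ.arity R) → A.Carrier)) → ℚ := fun s =>
    (A.rel s.1 s.2).untopD 0
  have hr : ∀ s : (Σ R : σ.Symbol, (Fin (σ.arity R) → A.Carrier)), A.rel s.1 s.2 ≠ ⊤ →
      A.rel s.1 s.2 = (r s : WithTop ℚ) := by
    intro s hs
    obtain ⟨q, hq⟩ := WithTop.ne_top_iff_exists.mp hs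
    simp only [r, ← hq, WithTop.untopD_coe]
  have hval : val X₁ A h = ((∑ c : X₁.Constraint, (c.wt : ℚ) * r (imageTuple h c) : ℚ) :
      WithTop ℚ) := by
    rw [val_eq_sum_constraint, WithTop.coe_sum]
    refine Finset.sum_congr rfl fun c _ => ?_
    rw [WithTop.coe_mul, ← hr (imageTuple h c) (hh c)]
    rfl
  have hobj : (averageAssignment X₂ h).objective = ((∑ c : X₂.Constraint,
      ∑ t, (averageAssignment X₂ h).onCon c t * (c.wt : ℚ) * r ⟨c.symb, t⟩ : ℚ) :
      WithTop ℚ) := by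
    unfold SAAssignment.objective
    rw [WithTop.coe_sum]
    refine Finset.sum_congr rfl fun c _ => ?_
    rw [WithTop.coe_sum]
    refine Finset.sum_congr rfl fun t _ => ?_
    by_cases ht : A.rel c.symb t = ⊤
    · rw [(averageAssignment_isFeasible hX hh).infinite_cost c t ht]
      simp
    · rw [WithTop.coe_mul, WithTop.coe_mul, ← hr ⟨c.symb, t⟩ ht]
  rw [hval, hobj, ← sum_average_fiber (fun c => iteratedDegree X₁ (.inr c))
    (fun c => iteratedDegree X₂ (.inr c)) hX.map_iteratedDegree.2]
  refine congrArg _ (Finset.sum_congr rfl fun c _ => ?_)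
  change _ = (∑ c' ∈ conClass X₁ (iteratedDegree X₂ (.inr c)), (c'.wt : ℚ) * r (imageTuple h c')) /
    ((conClass X₁ (iteratedDegree X₂ (.inr c))).card : ℚ)
  have hterm : ∀ c' ∈ conClass X₁ (iteratedDegree X₂ (.inr c)),
      (c'.wt : ℚ) * r (imageTuple h c') =
        ∑ t, if imageTuple h c' = ⟨c.symb, t⟩ then (c.wt : ℚ) * r ⟨c.symb, t⟩ else 0 := by
    intro c' hc'
    obtain ⟨y, hy, rfl, hwt, _⟩ := exists_tuple_of_iteratedDegree_eq (mem_conClass.mp hc')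
    rw [Finset.sum_eq_single (h ∘ y)]
    · refine Eq.trans ?_ (if_pos rfl).symm
      rw [← hwt]
      rfl
    · intro t _ hne
      exact if_neg fun ht => hne (eq_of_heq (Sigma.mk.inj ht).2).symm
    · exact fun hn => absurd (Finset.mem_univ _) hn
  rw [Finset.sum_congr rfl hterm, Finset.sum_comm, Finset.sum_div]
  refine Finset.sum_congr rfl fun t _ => ?_
  rw [← Finset.sum_filter, Finset.sum_const, nsmul_eq_mul]
  unfold averageAssignment
  simp only
  ring

theorem SADecides.closedUnderWL {A : ValuedStructure.{w, u} σ} {B : ValuedStructure.{w, v} σ}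
    (hd : SADecides A B) : ClosedUnderWL A B := by
  classical
  intro X₁ X₂ hX
  refine Finset.le_inf fun h _ => ?_
  by_cases hval : val X₁ A h = ⊤
  · rw [hval]
    exact le_top
  have hh : ∀ c : X₁.Constraint, A.rel c.symb (h ∘ c.tuple) ≠ ⊤ := by
    intro c hc
    rw [val_eq_sum_constraint] at hval
    refine hval (WithTop.sum_eq_top.mpr ⟨c, Finset.mem_univ c, ?_⟩)
    rw [hc, WithTop.mul_top]
    have : 0 < c.wt := c.2
    exact_mod_cast this.ne'
  rw [← toEReal_le_toEReal]
  refine (hd X₂).trans (sInf_le ⟨averageAssignment X₂ h, averageAssignment_isFeasible hX hh, ?_⟩)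
  rw [averageAssignment_objective hX hh]

end PVCSP

end

theorem theorem6p6 {σ : PVCSP.Signature} (A B : PVCSP.ValuedStructure σ)
    (hAB : PVCSP.IsTemplate A B) :
    PVCSP.ClosedUnderWL A B ↔ PVCSP.SADecides A B := by
  exact ⟨fun h => h.saDecides, fun h => h.closedUnderWL⟩
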